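/- **Setting.** Let $T>0$, $n,o,r,s\in\mathbb N$, and let $S_1=\{\psi\in\mathbb R:|\psi|=1\}$. For $i=1,\dots,n$ and $x\in\mathbb R^n$ let $F_i(x)\subset\mathbb R$ be a nonempty convex compact set whose support function $c(F_i(x),\psi)=\sup_{y\in F_i(x)}y\psi$ satisfies, for all $\psi\in S_1$, $$c(F_i(x),\psi)=\sum_{j=1}^{r}\max_{1\le q\le m(j)}f_{i,j,q}(x)\,\psi+\sum_{j=1}^{s}\min_{1\le p\le k(j)}g_{i,j,p}(x,\psi),$$ where $m(j),k(j)\ge1$, the functions $f_{i,j,q}:\mathbb R^n\to\mathbb R$ are continuously differentiable and $g_{i,j,p}(\cdot,\psi):\mathbb R^n\to\mathbb R$ is continuously differentiable for each $\psi\in S_1$. Let $e:\mathbb R^n\to\mathbb R^o$ be continuously differentiable, $x_0\in\mathbb R^n$, $J\subset\{1,\dots,n\}$ and $x_{T,j}\in\mathbb R$ ($j\in J$). Let $C_n[0,T]$ be the continuous functions $[0,T]\to\mathbb R^n$, and $P_n[0,T]$ the bounded functions $[0,T]\to\mathbb R^n$ that are continuous except at finitely many points. Put $\ell_i(\psi,x,z)=z_i\psi-c(F_i(x),\psi)$,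 $h_i(x,z)=\max_{\psi\in S_1}\max\{0,\ell_i(\psi,x,z)\}$, $h=(h_1,\dots,h_n)$, and for $(x,z)\in C_n[0,T]\times P_n[0,T]$ let $$\Delta_{x,z}(t)=x(t)-x_0-\int_0^t z(\tau)\,d\tau,\qquad \delta_{z,j}=x_{0,j}+\int_0^T z_j(t)\,dt-x_{T,j},$$ $$I(x,z)=\underbrace{\tfrac12\int_0^T\|h(x(t),z(t))\|^2dt}_{\varphi(x,z)}+\underbrace{\tfrac12\sum_{j\in J}\delta_{z,j}^2}_{\chi(z)}+\underbrace{\tfrac12\int_0^T\|e(x(t))\|^2dt}_{\omega(x)}+\underbrace{\tfrac12\int_0^T\|\Delta_{x,z}(t)\|^2dt}_{\upsilon(x,z)}.$$ Fix $\psi^0_i\in S_1$, $i=1,\dots,n$. Let $\psi_i^*=\psi_i^*(x,z)$ be the maximizer of $\ell_i(\cdot,x,z)$ on $S_1$ if $h_i(x,z)>0$, and $\psi_i^*=\psi^0_i$ if $h_i(x,z)=0$. Let $\mathbf e_1,\dots,\mathbf e_n$ be the standard basis of $\mathbb R^n$ and write elements of $\mathbb R^{2n}$ as pairs in $\mathbb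 R^n\times\mathbb R^n$. With $\mathcal R^1_{ij}(x,\psi)$ and $\mathcal R^2_{ij}(x,\psi)$ the sets of indices attaining $\max_q f_{i,j,q}(x)\psi$ and $\min_p g_{i,j,p}(x,\psi)$ respectively, put (sums and multiples of sets being taken elementwise, and $h_i$, $\psi_i^*$ being evaluated at $(x,z)$) $$\overline\partial\big(\tfrac12h_i^2\big)(x,z)=h_i\Big((0,\psi_i^*\mathbf e_i)+\sum_{j=1}^r\mathrm{co}\big\{(-\psi_i^*\nabla f_{i,j,q}(x),0):q\in\mathcal R^1_{ij}(x,\psi_i^*)\big\}\Big),$$ $$\underline\partial\big(\tfrac12h_i^2\big)(x,z)=h_i\sum_{j=1}^s\mathrm{co}\big\{(-\nabla_xg_{i,j,p}(x,\psi_i^*),0):p\in\mathcal R^2_{ij}(x,\psi_i^*)\big\},$$ and, for $(x,z)\in C_n[0,T]\times P_n[0,T]$ and $t\in[0,T]$, $$\overline\partial\mathcal I(x,z,t)=\sum_{i=1}^n\overline\partial\big(\tfrac12h_i^2\big)(x(t),z(t)),$$ $$\underline\partial\mathcal I(x,z,t)=\sum_{i=1}^n\underline\partial\big(\tfrac12h_i^2\big)(x(t),z(t))+\Big(0,\sum_{j\in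 J}\delta_{z,j}\mathbf e_j\Big)+\Big(\sum_{j=1}^oe_j(x(t))\nabla e_j(x(t)),0\Big)+\Big(\Delta_{x,z}(t),-\int_t^T\Delta_{x,z}(\tau)\,d\tau\Big).$$ **Theorem.** Let $(x^*,z^*)\in C_n[0,T]\times P_n[0,T]$. Suppose that $[0,T]$ can be divided into finitely many intervals such that, for each of these intervals and all $i$, $j$ and $\psi\in S_1$, at least one of the functions $f_{i,j,1}(\cdot)\psi,\dots,f_{i,j,m(j)}(\cdot)\psi$ is active (attains the maximum) at $x^*(t)$ for all $t$ in the interval, and at least one of the functions $g_{i,j,1}(\cdot,\psi),\dots,g_{i,j,k(j)}(\cdot,\psi)$ is active (attains the minimum) at $x^*(t)$ for all $t$ in the interval. 1. If $(x^*,z^*)$ minimizes $I$ over $C_n[0,T]\times P_n[0,T]$, then $$-\overline\partial\mathcal I(x^*,z^*,t)\subset\underline\partial\mathcal I(x^*,z^*,t)\quad\text{for almost every }t\in[0,T].\qquad(*)$$ 2. If $I(x^*,z^*)=0$, then condition $(*)$ is also sufficient for $(x^*,z^*)$ to minimize $I$ over $C_n[0,T]\times P_n[0,T]$. -/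

import Mathlib

open Set MeasureTheory
open scoped Pointwise

noncomputable section

namespace QDI

/-- `R^n` with its Euclidean structure. -/
abbrev E (n : ℕ) := EuclideanSpace ℝ (Fin n)

/-- The unit sphere `S_1` of `ℝ`. -/
abbrev S1 : Set ℝ := Metric.sphere 0 1

/-- The support function of a set of real numbers. -/
def supportFn (A : Set ℝ) (ψ : ℝ) : ℝ := sSup ((fun y => y * ψ) '' A)

/-- The data: the differential inclusion `x_i' ∈ F_i(x)`, whose support functions are, on the unit
sphere, sums of finite maxima of functions `f_{i,j,q}(x) ψ` and of finite minima of functions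
`g_{i,j,p}(x, ψ)`, all continuously differentiable in `x`; the surface `e(x) = 0`; the boundary
conditions `x(0) = x₀` and `x_j(T) = (x_T)_j` for `j ∈ J`. -/
structure Problem (n o r s : ℕ) where
  T : ℝ
  T_pos : 0 < T
  F : Fin n → E n → Set ℝ
  F_nonempty : ∀ i x, (F i x).Nonempty
  F_convex : ∀ i x, Convex ℝ (F i x)
  F_compact : ∀ i x, IsCompact (F i x)
  m : Fin r → ℕ
  m_pos : ∀ j, 0 < m j
  k : Fin s → ℕ
  k_pos : ∀ j, 0 < k j
  f : Fin n → (j : Fin r) → Fin (m j) → E n → ℝ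
  f_contDiff : ∀ i j q, ContDiff ℝ 1 (f i j q)
  g : Fin n → (j : Fin s) → Fin (k j) → E n → ℝ → ℝ
  g_contDiff : ∀ i j p, ∀ ψ ∈ S1, ContDiff ℝ 1 (fun x => g i j p x ψ)
  support_eq : ∀ i x, ∀ ψ ∈ S1, supportFn (F i x) ψ =
    (∑ j, ⨆ q, f i j q x * ψ) + ∑ j, ⨅ p, g i j p x ψ
  e : E n → E o
  e_contDiff : ContDiff ℝ 1 e
  x₀ : E n
  xT : Fin n → ℝ
  J : Finset (Fin n)

/-- `C_n[0,T]`. -/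
def IsC {n : ℕ} (T : ℝ) (x : ℝ → E n) : Prop := ContinuousOn x (Icc 0 T)

/-- `P_n[0,T]`: bounded on `[0,T]`, and continuous on `[0,T]` except at finitely many points. -/
def IsP {n : ℕ} (T : ℝ) (z : ℝ → E n) : Prop :=
  (∃ D : Finset ℝ, ∀ t ∈ Icc 0 T, t ∉ D → ContinuousWithinAt z (Icc 0 T) t) ∧
    ∃ M : ℝ, ∀ t ∈ Icc 0 T, ‖z t‖ ≤ M

namespace Problem

variable {n o r s : ℕ} (P : Problem n o r s)

/-- `ℓ_i(ψ, x, z) = z_i ψ - c(F_i(x), ψ)`. -/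
def ell (i : Fin n) (ψ : ℝ) (x z : E n) : ℝ := z i * ψ - supportFn (P.F i x) ψ

/-- `h_i(x, z) = max_{ψ ∈ S_1} max {0, ℓ_i(ψ, x, z)}`. -/
def h (i : Fin n) (x z : E n) : ℝ := ⨆ ψ : S1, max 0 (P.ell i ψ x z)

/-- `h(x, z) = (h_1(x, z), …, h_n(x, z))`. -/
def hvec (x z : E n) : E n := WithLp.toLp 2 (fun i => P.h i x z)

/-- `φ(x, z) = ½ ∫_0^T ‖h(x(t), z(t))‖² dt`. -/
def phi (x z : ℝ → E n) : ℝ := (1 / 2) * ∫ t in (0 : ℝ)..P.T, ‖P.hvec (x t) (z t)‖ ^ 2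

/-- The deviation of the `j`-th coordinate from its prescribed value at the right endpoint. -/
def endDev (z : ℝ → E n) (j : Fin n) : ℝ := P.x₀ j + (∫ t in (0 : ℝ)..P.T, z t j) - P.xT j

/-- `χ(z) = ½ ∑_{j ∈ J} (x₀_j + ∫_0^T z_j(t) dt - x_T_j)²`. -/
def chi (z : ℝ → E n) : ℝ := (1 / 2) * ∑ j ∈ P.J, P.endDev z j ^ 2

/-- `ω(x) = ½ ∫_0^T ‖e(x(t))‖² dt`. -/
def omega (x : ℝ → E n) : ℝ := (1 / 2) * ∫ t in (0 : ℝ)..P.T, ‖P.e (x t)‖ ^ 2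

/-- `x(t) - x₀ - ∫_0^t z(τ) dτ`. -/
def dev (x z : ℝ → E n) (t : ℝ) : E n := x t - P.x₀ - ∫ τ in (0 : ℝ)..t, z τ

/-- `υ(x, z) = ½ ∫_0^T ‖x(t) - x₀ - ∫_0^t z(τ) dτ‖² dt`. -/
def upsilon (x z : ℝ → E n) : ℝ := (1 / 2) * ∫ t in (0 : ℝ)..P.T, ‖P.dev x z t‖ ^ 2

/-- `I = φ + χ + ω + υ`. -/
def I (x z : ℝ → E n) : ℝ := P.phi x z + P.chi z + P.omega x + P.upsilon x z

/-- `(x, z)` minimizes `I` over `C_n[0,T] × P_n[0,T]`. -/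
def IsMinimizer (x z : ℝ → E n) : Prop :=
  IsC P.T x ∧ IsP P.T z ∧ ∀ x' z', IsC P.T x' → IsP P.T z' → P.I x z ≤ P.I x' z'

/-- The set of active indices in `max_q f_{i,j,q}(x) ψ`. -/
def activeMax (i : Fin n) (j : Fin r) (ψ : ℝ) (x : E n) : Set (Fin (P.m j)) :=
  {q | P.f i j q x * ψ = ⨆ q', P.f i j q' x * ψ}

/-- The set of active indices in `min_p g_{i,j,p}(x, ψ)`. -/
def activeMin (i : Fin n) (j : Fin s) (ψ : ℝ) (x : E n) : Set (Fin (P.k j)) :=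
  {p | P.g i j p x ψ = ⨅ p', P.g i j p' x ψ}

/-- The interval `[0,T]` is divided into finitely many intervals, throughout each of which, for
every `i`, `j` and `ψ ∈ S_1`, some function under the maximum (minimum) is active along `x`. -/
def FiniteSplitting (x : ℝ → E n) : Prop :=
  ∃ (N : ℕ) (τ : Fin (N + 1) → ℝ), StrictMono τ ∧ τ 0 = 0 ∧ τ (Fin.last N) = P.T ∧
    ∀ (l : Fin N) (i : Fin n), ∀ ψ ∈ S1,
      (∀ j, ∃ q, ∀ t ∈ Ioo (τ l.castSucc) (τ l.succ), q ∈ P.activeMax i j ψ (x t)) ∧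
      (∀ j, ∃ p, ∀ t ∈ Ioo (τ l.castSucc) (τ l.succ), p ∈ P.activeMin i j ψ (x t))

theorem exists_maximizer (i : Fin n) (x z : E n) :
    ∃ ψ, ψ ∈ S1 ∧ IsMaxOn (fun ψ => P.ell i ψ x z) S1 ψ := by
  have hS : (S1 : Set ℝ) = {1, -1} := by
    ext a
    simp only [S1, mem_sphere_iff_norm, sub_zero, Real.norm_eq_abs, mem_insert_iff,
      mem_singleton_iff]
    exact abs_eq zero_le_one
  have hfin : (S1 : Set ℝ).Finite := by rw [hS]; exact Set.toFinite _
  have hne : (S1 : Set ℝ).Nonempty := by rw [hS]; exact ⟨1, by simp⟩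
  obtain ⟨ψ, h1, h2⟩ := Set.exists_max_image S1 (fun ψ => P.ell i ψ x z) hfin hne
  exact ⟨ψ, h1, fun y hy => h2 y hy⟩

open Classical in
/-- `ψ_i*(x, z)`: the maximizer of `ℓ_i(·, x, z)` on `S_1` if `h_i(x, z) > 0`, and a fixed element
`ψ⁰_i` otherwise. -/
def psiStar (ψ0 : Fin n → ℝ) (i : Fin n) (x z : E n) : ℝ :=
  if 0 < P.h i x z then Classical.choose (P.exists_maximizer i x z) else ψ0 i

/-- The superdifferential of `½ h_i²` at `(x, z)`. -/
def superHalfSq (ψ0 : Fin n → ℝ) (i : Fin n) (x z : E n) : Set (E n × E n) :=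
  P.h i x z • ({((0 : E n), P.psiStar ψ0 i x z • EuclideanSpace.single i (1 : ℝ))} +
    ∑ j, convexHull ℝ ((fun q => (-(P.psiStar ψ0 i x z • gradient (P.f i j q) x), (0 : E n))) ''
      P.activeMax i j (P.psiStar ψ0 i x z) x))

/-- The subdifferential of `½ h_i²` at `(x, z)`. -/
def subHalfSq (ψ0 : Fin n → ℝ) (i : Fin n) (x z : E n) : Set (E n × E n) :=
  P.h i x z • ∑ j, convexHull ℝ
    ((fun p => (-gradient (fun y => P.g i j p y (P.psiStar ψ0 i x z)) x, (0 : E n))) ''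
      P.activeMin i j (P.psiStar ψ0 i x z) x)

/-- The gradient of `χ`, as an element of `R^n × R^n`. -/
def gradChi (z : ℝ → E n) : E n × E n :=
  (0, ∑ j ∈ P.J, P.endDev z j • EuclideanSpace.single j (1 : ℝ))

/-- The gradient of `ω` at the time `t`, as an element of `R^n × R^n`. -/
def gradOmega (x : ℝ → E n) (t : ℝ) : E n × E n :=
  (∑ j, P.e (x t) j • gradient (fun y => P.e y j) (x t), 0)

/-- The gradient of `υ` at the time `t`. -/
def gradUpsilon (x z : ℝ → E n) (t : ℝ) : E n × E n :=
  (P.dev x z t, -∫ τ in t..P.T, P.dev x z τ)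

/-- The superdifferential of the integrand, a subset of `R^n × R^n`. -/
def superI (ψ0 : Fin n → ℝ) (x z : ℝ → E n) (t : ℝ) : Set (E n × E n) :=
  ∑ i, P.superHalfSq ψ0 i (x t) (z t)

/-- The subdifferential of the integrand, a subset of `R^n × R^n`. -/
def subI (ψ0 : Fin n → ℝ) (x z : ℝ → E n) (t : ℝ) : Set (E n × E n) :=
  (∑ i, P.subHalfSq ψ0 i (x t) (z t)) + {P.gradChi z} + {P.gradOmega x t} + {P.gradUpsilon x z t}

/-- The minimum condition: `-∂̄𝓘(x, z, t) ⊂ ∂̲𝓘(x, z, t)` for almost every `t ∈ [0,T]`. -/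
def MinCondition (ψ0 : Fin n → ℝ) (x z : ℝ → E n) : Prop :=
  ∀ᵐ t ∂(volume.restrict (Icc 0 P.T)), -P.superI ψ0 x z t ⊆ P.subI ψ0 x z t

end Problem

end QDI

end

namespace QDI

open Filter Topology

/-! Necessity is a first variation argument, with `x` and `z` varied independently because υ only
penalizes the relation between them. For a constant `d = (a, b)` and a continuous `φ ≥ 0`, the
variation `(x + εφa, z + εφb)` stays admissible, and the right derivative of `I` at `ε = 0` is `∫
φ(t) · density(t, d) dt` (`hasDerivWithinAt_I`). At a minimizer this is nonnegative for every such
`φ`, so `density(t, d) ≥ 0` for almost every `t`. A countable dense set of directions and continuity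
in `d` make the null set independent of `d`.

For fixed `t` the density is the minimum of `⟨v, d⟩` over the superdifferential plus the maximum of
`⟨w, d⟩` over the subdifferential. If some point of `-∂̄𝓘` lay outside the compact convex set `∂̲𝓘`,
a separating functional would give a `d` with negative density (`neg_superI_subset_subI`).

The nonsmooth calculus rests on `S_1 = {1, -1}` and `ℓ_i(1) + ℓ_i(-1) ≤ 0`. At most one of the two
values is positive, so `½h_i²` is the sum of the two functions `½ max(0, ℓ_i(±1))²`, and `s ↦ ½
max(0, s)²` is continuously differentiable.

Sufficiency when `I = 0` holds because `I` is a sum of squares. -/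

theorem iInf_eq_neg_iSup_neg {ι : Type*} (v : ι → ℝ) : ⨅ i, v i = -⨆ i, -v i := by
  have h := Real.mul_iSup_of_nonpos (r := -1) (by norm_num) (fun i => -v i)
  simpa using h.symm

/-! ### Finite maxima and minima: right derivatives and Lipschitz continuity. -/

section FiniteSuprema

variable {ι : Type*} [Fintype ι]

theorem lipschitzWith_iSup_real : LipschitzWith 1 (fun v : ι → ℝ => ⨆ i, v i) := by
  rcases isEmpty_or_nonempty ι with hι | hι
  · simpa using LipschitzWith.const' (K := 1) (0 : ℝ)
  · refine LipschitzWith.of_le_add fun v w => ciSup_le fun i => ?_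
    have h1 : v i - w i ≤ dist v w :=
      (le_abs_self _).trans ((Real.dist_eq _ _).symm.le.trans (dist_le_pi_dist v w i))
    have h2 : w i ≤ ⨆ i, w i := le_ciSup (Finite.bddAbove_range w) i
    linarith

/-- By continuity, inactive functions stay strictly below an active one just to the right of `a`, so
only active indices matter there. Slopes to the right have a positive denominator and hence commute
with the supremum, which is continuous in the vector of slopes. -/
theorem hasDerivWithinAt_iSup [Nonempty ι] {φ : ι → ℝ → ℝ} {φ' : ι → ℝ} {a : ℝ} {A : Set ι}
    (hA : ∀ q, q ∈ A ↔ φ q a = ⨆ q', φ q' a)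
    (h : ∀ q, HasDerivWithinAt (φ q) (φ' q) (Ioi a) a) :
    HasDerivWithinAt (fun t => ⨆ q, φ q t)
      (⨆ q : A, φ' q) (Ioi a) a := by
  obtain rfl : A = {q | φ q a = ⨆ q', φ q' a} := Set.ext hA
  set M := ⨆ q', φ q' a with hM
  obtain ⟨r, hr⟩ : ∃ r, φ r a = M := exists_eq_ciSup_of_finite
  have : Nonempty {q | φ q a = M} := ⟨⟨r, hr⟩⟩
  rw [hasDerivWithinAt_iff_tendsto_slope' self_notMem_Ioi]
  have hlim : Tendsto (fun t => ⨆ q : {q | φ q a = M}, slope (φ q) a t) (𝓝[>] a)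
      (𝓝 (⨆ q : {q | φ q a = M}, φ' q)) := by
    refine (lipschitzWith_iSup_real.continuous.tendsto
      (fun q : {q | φ q a = M} => φ' q)).comp (tendsto_pi_nhds.2 fun q => ?_)
    exact (hasDerivWithinAt_iff_tendsto_slope' self_notMem_Ioi).1 (h q)
  refine hlim.congr' ?_
  have hev : ∀ᶠ t in 𝓝[>] a, ∀ q, φ q a ≠ M → φ q t < φ r t := by
    refine eventually_all.2 fun q => ?_
    by_cases hq : φ q a = M
    · exact Eventually.of_forall fun t h => absurd hq h
    · have hlt : φ q a < φ r a := by
        rw [hr]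
        exact lt_of_le_of_ne (le_ciSup (Finite.bddAbove_range fun q' => φ q' a) q) hq
      filter_upwards [((h q).continuousWithinAt.tendsto).eventually_lt
        ((h r).continuousWithinAt.tendsto) hlt] with t ht _ using ht
  filter_upwards [hev, self_mem_nhdsWithin] with t ht hta
  have hpos : 0 ≤ (t - a)⁻¹ := inv_nonneg.2 (sub_nonneg.2 (le_of_lt hta))
  have hsup : ⨆ q, φ q t = ⨆ q : {q | φ q a = M}, φ q t := by
    apply le_antisymm
    · refine ciSup_le fun q => ?_
      have hb : BddAbove (range fun q : {q | φ q a = M} => φ q t) := Finite.bddAbove_range _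
      by_cases hq : φ q a = M
      · exact le_ciSup hb ⟨q, hq⟩
      · exact (ht q hq).le.trans (le_ciSup hb ⟨r, hr⟩)
    · exact ciSup_le fun q => le_ciSup (Finite.bddAbove_range fun q => φ q t) q.1
  have hsub : (⨆ q : {q | φ q a = M}, φ q t) - M = ⨆ q : {q | φ q a = M}, (φ q t - M) :=
    ciSup_sub (Finite.bddAbove_range _) M
  simp only [slope_def_module, ← hM, hsup, smul_eq_mul, hsub]
  rw [Real.mul_iSup_of_nonneg hpos]
  exact iSup_congr fun q => by rw [q.2]

theorem hasDerivWithinAt_iInf [Nonempty ι] {φ : ι → ℝ → ℝ} {φ' : ι → ℝ} {a : ℝ} {A : Set ι}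
    (hA : ∀ q, q ∈ A ↔ φ q a = ⨅ q', φ q' a)
    (h : ∀ q, HasDerivWithinAt (φ q) (φ' q) (Ioi a) a) :
    HasDerivWithinAt (fun t => ⨅ q, φ q t)
      (⨅ q : A, φ' q) (Ioi a) a := by
  simp only [iInf_eq_neg_iSup_neg] at hA ⊢
  refine (hasDerivWithinAt_iSup (fun q => ?_) fun q => (h q).neg).neg
  rw [hA q, eq_neg_iff_add_eq_zero, Pi.neg_apply, neg_eq_iff_add_eq_zero]
  rfl

theorem locallyLipschitz_pi {X : Type*} [PseudoEMetricSpace X] {F : ι → X → ℝ}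
    (h : ∀ i, LocallyLipschitz (F i)) : LocallyLipschitz (fun x i => F i x) := by
  intro x
  choose K t ht hK using fun i => h i x
  refine ⟨∑ i, K i, ⋂ i, t i, (Filter.iInter_mem).2 ht, fun y hy w hw => ?_⟩
  refine edist_pi_le_iff.2 fun i => ?_
  refine (hK i (mem_iInter.1 hy i) (mem_iInter.1 hw i)).trans ?_
  gcongr
  exact Finset.single_le_sum (fun _ _ => zero_le) (Finset.mem_univ i)

theorem locallyLipschitz_iSup {X : Type*} [PseudoEMetricSpace X] {F : ι → X → ℝ}
    (h : ∀ i, LocallyLipschitz (F i)) : LocallyLipschitz (fun x => ⨆ i, F i x) :=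
  lipschitzWith_iSup_real.locallyLipschitz.comp (locallyLipschitz_pi h)

theorem locallyLipschitz_iInf {X : Type*} [PseudoEMetricSpace X] {F : ι → X → ℝ}
    (h : ∀ i, LocallyLipschitz (F i)) : LocallyLipschitz (fun x => ⨅ i, F i x) := by
  simp only [iInf_eq_neg_iSup_neg]
  exact (locallyLipschitz_iSup fun i => (h i).neg).neg

theorem locallyLipschitz_sum {X : Type*} [PseudoEMetricSpace X] {F : ι → X → ℝ}
    (h : ∀ i, LocallyLipschitz (F i)) : LocallyLipschitz (fun x => ∑ i, F i x) := by
  have hc : ContDiff ℝ 1 (fun v : ι → ℝ => ∑ i, v i) := by fun_prop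
  exact hc.locallyLipschitz.comp (locallyLipschitz_pi h)

end FiniteSuprema

/-! ### One-sided derivatives along lines. -/

theorem hasDerivAt_half_sq_posPart (s : ℝ) :
    HasDerivAt (fun s : ℝ => (1 / 2) * max 0 s ^ 2) (max 0 s) s := by
  rcases lt_trichotomy s 0 with hs | rfl | hs
  · have : (fun s : ℝ => (1 / 2) * max 0 s ^ 2) =ᶠ[𝓝 s] fun _ => 0 := by
      filter_upwards [gt_mem_nhds hs] with y hy
      simp [max_eq_left hy.le]
    rw [max_eq_left hs.le]
    exact (hasDerivAt_const s (0 : ℝ)).congr_of_eventuallyEq this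
  · rw [max_self, hasDerivAt_iff_isLittleO]
    have h1 : (fun y : ℝ => (1 / 2) * max 0 y ^ 2) =O[𝓝 0] fun y => y ^ 2 := by
      refine Asymptotics.IsBigO.of_bound 1 (Eventually.of_forall fun y => ?_)
      rw [Real.norm_of_nonneg (by positivity), Real.norm_of_nonneg (by positivity)]
      rcases le_total 0 y with hy | hy
      · rw [max_eq_right hy]; nlinarith
      · rw [max_eq_left hy]; nlinarith
    have h2 : (fun y : ℝ => y ^ 2) =o[𝓝 0] fun y => y := by
      simpa using Asymptotics.isLittleO_pow_pow (𝕜 := ℝ) (m := 1) (n := 2) (by norm_num)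
    simpa using h1.trans_isLittleO h2
  · have : (fun s : ℝ => (1 / 2) * max 0 s ^ 2) =ᶠ[𝓝 s] fun s => (1 / 2) * s ^ 2 := by
      filter_upwards [lt_mem_nhds hs] with y hy
      simp [max_eq_right hy.le]
    rw [max_eq_right hs.le]
    refine HasDerivAt.congr_of_eventuallyEq ?_ this
    simpa using ((hasDerivAt_pow 2 s).const_mul (1 / 2 : ℝ))

theorem nonneg_of_hasDerivWithinAt_of_forall_le {J : ℝ → ℝ} {J' a : ℝ}
    (h : HasDerivWithinAt J J' (Ioi a) a) (hJ : ∀ t, J a ≤ J t) : 0 ≤ J' := by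
  refine ge_of_tendsto ((hasDerivWithinAt_iff_tendsto_slope' self_notMem_Ioi).1 h) ?_
  filter_upwards [self_mem_nhdsWithin] with t ht
  rw [slope_def_module, smul_eq_mul]
  exact mul_nonneg (inv_nonneg.2 (sub_nonneg.2 (le_of_lt ht))) (sub_nonneg.2 (hJ t))

theorem hasDerivAt_comp_line {F : Type*} [NormedAddCommGroup F] [InnerProductSpace ℝ F]
    [CompleteSpace F] {f : F → ℝ} {x : F} (hf : DifferentiableAt ℝ f x) (a : F) :
    HasDerivAt (fun α : ℝ => f (x + α • a)) (inner ℝ (gradient f x) a) 0 := by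
  have h1 : HasDerivAt (fun α : ℝ => x + α • a) a 0 := by
    simpa using ((hasDerivAt_id (0 : ℝ)).smul_const a).const_add x
  have h2 : HasFDerivAt f (InnerProductSpace.toDual ℝ F (gradient f x)) (x + (0 : ℝ) • a) := by
    simpa using hf.hasGradientAt.hasFDerivAt
  exact h2.comp_hasDerivAt (0 : ℝ) h1

/-- Right directional derivatives are only positively homogeneous in the direction; this is what
forces the weights `φ` to be nonnegative. -/
theorem hasDerivWithinAt_line_smul {V : Type*} [NormedAddCommGroup V] [NormedSpace ℝ V]
    {L : V → ℝ} {p d : V} {l c : ℝ}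
    (h : HasDerivWithinAt (fun α : ℝ => L (p + α • d)) l (Ioi 0) 0) (hc : 0 ≤ c) :
    HasDerivWithinAt (fun α : ℝ => L (p + α • c • d)) (c * l) (Ioi 0) 0 := by
  -- The closed half-line is needed for `c = 0`, where `α ↦ α * c` takes the value `0`.
  rw [hasDerivWithinAt_Ioi_iff_Ici] at h ⊢
  have h1 : HasDerivWithinAt (fun α : ℝ => α * c) c (Ici 0) 0 := by
    simpa using ((hasDerivAt_id (0 : ℝ)).mul_const c).hasDerivWithinAt
  have h2 : HasDerivWithinAt (fun α : ℝ => L (p + α • d)) l (Ici 0) ((0 : ℝ) * c) := by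
    simpa using h
  have h3 := h2.scomp (0 : ℝ) h1 (fun α hα => mul_nonneg hα hc)
  simpa [Function.comp_def, smul_smul] using h3

theorem integrable_comp_of_bounded {V : Type*} [NormedAddCommGroup V] [ProperSpace V]
    {α : Type*} [MeasurableSpace α] {μ : Measure α} [IsFiniteMeasure μ] {L : V → ℝ} (hL : Continuous L)
    {p : α → V} (hp : AEStronglyMeasurable p μ) {M : ℝ} (hM : ∀ᵐ t ∂μ, ‖p t‖ ≤ M) :
    Integrable (fun t => L (p t)) μ := by
  obtain ⟨C, hC⟩ := (isCompact_closedBall (0 : V) M).exists_bound_of_continuousOn hL.continuousOn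
  refine Integrable.of_bound (hL.comp_aestronglyMeasurable hp) C ?_
  filter_upwards [hM] with t ht using hC _ (mem_closedBall_zero_iff.2 ht)

/-! ### Differentiation under the integral sign. -/

section Integral

variable {V : Type*} [NormedAddCommGroup V] [NormedSpace ℝ V]
  {α : Type*} [MeasurableSpace α] {μ : Measure α}

/-- All the points involved lie in the ball of radius `M + N`, which is compact. The constant
dominates the difference quotients uniformly in `p` and `u`. -/
theorem exists_lipschitz_bound [ProperSpace V] {L : V → ℝ} (hL : LocallyLipschitz L) (M N : ℝ) :
    ∃ C, 0 ≤ C ∧ ∀ p u : V, ‖p‖ ≤ M → ‖u‖ ≤ N → ∀ ε ∈ Ioc (0 : ℝ) 1,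
      |L (p + ε • u) - L p| ≤ C * ε := by
  obtain ⟨K, hK⟩ := hL.locallyLipschitzOn.exists_lipschitzOnWith_of_compact
    (isCompact_closedBall (0 : V) (M + N))
  refine ⟨K * |N|, by positivity, fun p u hp hu ε hε => ?_⟩
  have hN : 0 ≤ N := (norm_nonneg u).trans hu
  have hεu : ‖ε • u‖ ≤ ε * N := by
    rw [norm_smul, Real.norm_of_nonneg hε.1.le]
    exact mul_le_mul_of_nonneg_left hu hε.1.le
  have hεN : ε * N ≤ N := mul_le_of_le_one_left hN hε.2
  have h1 := hK.dist_le_mul (p + ε • u)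
    (mem_closedBall_zero_iff.2 ((norm_add_le _ _).trans (by linarith))) p
    (mem_closedBall_zero_iff.2 (by linarith))
  rw [Real.dist_eq, dist_eq_norm, add_sub_cancel_left] at h1
  refine h1.trans ?_
  rw [abs_of_nonneg hN, mul_assoc, mul_comm N]
  exact mul_le_mul_of_nonneg_left hεu K.2

theorem abs_le_of_hasDerivWithinAt_line {L : V → ℝ} {p u : V} {l C : ℝ}
    (h : HasDerivWithinAt (fun ε : ℝ => L (p + ε • u)) l (Ioi 0) 0)
    (hC : ∀ ε ∈ Ioc (0 : ℝ) 1, |L (p + ε • u) - L p| ≤ C * ε) : |l| ≤ C := by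
  have ht := ((hasDerivWithinAt_iff_tendsto_slope' self_notMem_Ioi).1 h).abs
  refine le_of_tendsto ht ?_
  filter_upwards [Ioc_mem_nhdsGT (zero_lt_one' ℝ)] with ε hε
  rw [slope_def_module, smul_eq_mul, abs_mul, sub_zero, abs_of_pos (inv_pos.2 hε.1),
    inv_mul_le_iff₀ hε.1, zero_smul, add_zero, mul_comm]
  exact hC ε hε

/-- The derivative is an almost everywhere limit of measurable difference quotients, so the
measurability of active index sets and of `ψ*` along a path never has to be examined. -/
theorem aestronglyMeasurable_of_hasDerivWithinAt_line {L : V → ℝ} (hL : Continuous L)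
    {p u : α → V} (hp : AEStronglyMeasurable p μ) (hu : AEStronglyMeasurable u μ) {l : α → ℝ}
    (hl : ∀ᵐ t ∂μ, HasDerivWithinAt (fun ε : ℝ => L (p t + ε • u t)) (l t) (Ioi 0) 0) :
    AEStronglyMeasurable l μ := by
  refine aestronglyMeasurable_of_tendsto_ae (𝓝[>] (0 : ℝ))
    (f := fun ε t => slope (fun ε : ℝ => L (p t + ε • u t)) 0 ε) (fun ε => ?_) ?_
  · simp only [slope_def_module, smul_eq_mul]
    exact ((hL.comp_aestronglyMeasurable (hp.add (hu.const_smul ε))).sub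
      (hL.comp_aestronglyMeasurable (hp.add (hu.const_smul (0 : ℝ))))).const_mul _
  · filter_upwards [hl] with t ht
    exact (hasDerivWithinAt_iff_tendsto_slope' self_notMem_Ioi).1 ht

theorem hasDerivWithinAt_integral_line [ProperSpace V] [IsFiniteMeasure μ] {L : V → ℝ} (hL : LocallyLipschitz L)
    {p u : α → V} (hp : AEStronglyMeasurable p μ) (hu : AEStronglyMeasurable u μ) {M N : ℝ}
    (hM : ∀ᵐ t ∂μ, ‖p t‖ ≤ M) (hN : ∀ᵐ t ∂μ, ‖u t‖ ≤ N) {l : α → ℝ}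
    (hl : ∀ᵐ t ∂μ, HasDerivWithinAt (fun ε : ℝ => L (p t + ε • u t)) (l t) (Ioi 0) 0) :
    HasDerivWithinAt (fun ε : ℝ => ∫ t, L (p t + ε • u t) ∂μ) (∫ t, l t ∂μ) (Ioi 0) 0 := by
  have hLc := hL.continuous
  obtain ⟨C, hC0, hC⟩ := exists_lipschitz_bound hL M N
  rw [hasDerivWithinAt_iff_tendsto_slope' self_notMem_Ioi]
  have hmeas : ∀ ε : ℝ, AEStronglyMeasurable (fun t => L (p t + ε • u t)) μ := fun ε =>
    hLc.comp_aestronglyMeasurable (hp.add (hu.const_smul ε))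
  have hint : ∀ ε : ℝ, Integrable (fun t => L (p t + ε • u t)) μ := fun ε => by
    refine integrable_comp_of_bounded hLc (M := M + |ε| * N) (hp.add (hu.const_smul ε)) ?_
    filter_upwards [hM, hN] with t h1 h2
    refine (norm_add_le _ _).trans (add_le_add h1 ?_)
    rw [norm_smul, Real.norm_eq_abs]
    exact mul_le_mul_of_nonneg_left h2 (abs_nonneg _)
  have hslope : ∀ ε : ℝ, slope (fun ε : ℝ => ∫ t, L (p t + ε • u t) ∂μ) 0 ε =
      ∫ t, slope (fun ε : ℝ => L (p t + ε • u t)) 0 ε ∂μ := fun ε => by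
    simp only [slope_def_module, smul_eq_mul]
    rw [integral_const_mul, integral_sub (hint ε) (hint 0)]
  rw [tendsto_congr hslope]
  refine tendsto_integral_filter_of_dominated_convergence (fun _ => C) ?_ ?_
    (integrable_const C) ?_
  · refine Eventually.of_forall fun ε => ?_
    simp only [slope_def_module, smul_eq_mul]
    exact ((hmeas ε).sub (hmeas 0)).const_mul _
  · filter_upwards [Ioc_mem_nhdsGT (zero_lt_one' ℝ)] with ε hε
    filter_upwards [hM, hN] with t h1 h2
    rw [slope_def_module, smul_eq_mul, Real.norm_eq_abs, abs_mul, sub_zero,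
      abs_of_pos (inv_pos.2 hε.1), inv_mul_le_iff₀ hε.1, zero_smul, add_zero, mul_comm]
    exact hC _ _ h1 h2 ε hε
  · filter_upwards [hl] with t ht
    exact (hasDerivWithinAt_iff_tendsto_slope' self_notMem_Ioi).1 ht

end Integral

/-- A bounded function whose integral against each nonnegative continuous function is nonnegative
is nonnegative almost everywhere. -/
theorem ae_nonneg_of_forall_integral_continuous_mul {μ : Measure ℝ} [IsFiniteMeasure μ]
    [μ.Regular] {D : ℝ → ℝ} (hD : AEStronglyMeasurable D μ) {C : ℝ} (hC : ∀ᵐ t ∂μ, |D t| ≤ C)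
    (h : ∀ φ : ℝ → ℝ, Continuous φ → (∀ t, 0 ≤ φ t) → HasCompactSupport φ →
      0 ≤ ∫ t, φ t * D t ∂μ) : 0 ≤ᵐ[μ] D := by
  have hDint : Integrable D μ := Integrable.of_bound hD C hC
  refine ae_nonneg_of_forall_setIntegral_nonneg hDint fun s hs _ => ?_
  refine le_of_forall_pos_le_add fun ε hε => ?_
  have hC1 : 0 < |C| + 1 := by positivity
  have hsi : Integrable (s.indicator fun _ => (1 : ℝ)) μ := (integrable_const 1).indicator hs
  -- The indicator of `s` is approximated in L¹; the tolerance absorbs the bound on `D`, and `|C| +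
  -- 1` is positive for every `C`.
  obtain ⟨φ, hφs, hφ, hφc, hφi⟩ :=
    hsi.exists_hasCompactSupport_integral_sub_le (ε := ε / (|C| + 1)) (by positivity)
  -- Taking the positive part makes the test function nonnegative and moves it no farther from the
  -- indicator, which is itself nonnegative.
  set ψ : ℝ → ℝ := fun t => max (φ t) 0 with hψ
  have hψs : HasCompactSupport ψ :=
    hφs.comp_left (g := fun y : ℝ => max y 0) (max_self 0)
  have hψc : Continuous ψ := hφc.max continuous_const
  have hψi : Integrable ψ μ := hφi.pos_part
  have h0 := h ψ hψc (fun t => le_max_right _ _) hψs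
  have hψD : Integrable (fun t => ψ t * D t) μ := hψi.mul_bdd (c := C) hD hC
  have hsD : Integrable (fun t => s.indicator (fun _ => (1 : ℝ)) t * D t) μ :=
    hsi.mul_bdd (c := C) hD hC
  have hset : ∫ t in s, D t ∂μ = ∫ t, s.indicator (fun _ => (1 : ℝ)) t * D t ∂μ := by
    rw [← integral_indicator hs]
    refine integral_congr_ae (Eventually.of_forall fun t => ?_)
    by_cases ht : t ∈ s <;> simp [ht]
  have hdiff : ∫ t, ψ t * D t ∂μ - ∫ t, s.indicator (fun _ => (1 : ℝ)) t * D t ∂μ ≤ ε := by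
    rw [← integral_sub hψD hsD]
    calc ∫ t, (ψ t * D t - s.indicator (fun _ => (1 : ℝ)) t * D t) ∂μ
        ≤ ∫ t, ‖s.indicator (fun _ => (1 : ℝ)) t - φ t‖ * (|C| + 1) ∂μ := by
          refine integral_mono_ae (hψD.sub hsD) ((hsi.sub hφi).norm.mul_const _) ?_
          filter_upwards [hC] with t ht
          have h1 : |ψ t - s.indicator (fun _ => (1 : ℝ)) t| ≤
              ‖s.indicator (fun _ => (1 : ℝ)) t - φ t‖ := by
            have h2 : (0 : ℝ) ≤ s.indicator (fun _ => (1 : ℝ)) t :=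
              indicator_nonneg (fun _ _ => zero_le_one) t
            have h3 := abs_max_sub_max_le_abs (φ t) (s.indicator (fun _ => (1 : ℝ)) t) 0
            rw [max_eq_left h2] at h3
            rwa [Real.norm_eq_abs, abs_sub_comm (s.indicator _ _)]
          rw [← sub_mul]
          refine (le_abs_self _).trans ?_
          rw [abs_mul]
          have h4 : |D t| ≤ |C| + 1 := ht.trans ((le_abs_self C).trans (by linarith))
          exact mul_le_mul h1 h4 (abs_nonneg _) (norm_nonneg _)
      _ ≤ ε := by
          rw [integral_mul_const]
          exact (le_div_iff₀ hC1).1 hφ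
  rw [hset]
  linarith

/-- Exchanging the order of integration over a triangle. -/
theorem integral_mul_integral_left {f φ : ℝ → ℝ} {T : ℝ} (hT : 0 ≤ T)
    (hf : ContinuousOn f (Icc 0 T)) (hφ : Continuous φ) :
    ∫ t in (0 : ℝ)..T, f t * ∫ τ in (0 : ℝ)..t, φ τ =
      ∫ t in (0 : ℝ)..T, φ t * ∫ τ in t..T, f τ := by
  -- A continuous extension to the whole line makes the primitive differentiable at the endpoints
  -- too.
  set g : ℝ → ℝ := IccExtend hT ((Icc 0 T).domRestrict f) with hg
  have hgc : Continuous g := hf.domRestrict.Icc_extend'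
  have hgf : EqOn g f (Icc 0 T) := fun t ht => by
    rw [hg, IccExtend_of_mem hT _ ht]; rfl
  have h1 : ∫ t in (0 : ℝ)..T, f t * ∫ τ in (0 : ℝ)..t, φ τ =
      ∫ t in (0 : ℝ)..T, g t * ∫ τ in (0 : ℝ)..t, φ τ := by
    refine intervalIntegral.integral_congr fun t ht => ?_
    rw [uIcc_of_le hT] at ht
    simp only [hgf ht]
  have h2 : ∫ t in (0 : ℝ)..T, φ t * ∫ τ in t..T, f τ =
      ∫ t in (0 : ℝ)..T, φ t * ∫ τ in t..T, g τ := by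
    refine intervalIntegral.integral_congr fun t ht => ?_
    rw [uIcc_of_le hT] at ht
    congr 1
    refine intervalIntegral.integral_congr fun τ hτ => ?_
    rw [uIcc_of_le ht.2] at hτ
    exact (hgf ⟨ht.1.trans hτ.1, hτ.2⟩).symm
  rw [h1, h2]
  have hu : ∀ t, HasDerivAt (fun t => ∫ τ in (0 : ℝ)..t, φ τ) (φ t) t := fun t =>
    hφ.integral_hasStrictDerivAt 0 t |>.hasDerivAt
  have hv : ∀ t, HasDerivAt (fun t => ∫ τ in t..T, g τ) (-g t) t := fun t =>
    intervalIntegral.integral_hasDerivAt_left (hgc.intervalIntegrable _ _)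
      (hgc.stronglyMeasurableAtFilter _ _) hgc.continuousAt
  -- Integration by parts; both boundary terms vanish, as one primitive starts at `0` and the other
  -- ends at `T`.
  have h3 := intervalIntegral.integral_mul_deriv_eq_deriv_mul (a := 0) (b := T)
    (fun t _ => hu t) (fun t _ => hv t) (hφ.intervalIntegrable _ _)
    (hgc.neg.intervalIntegrable _ _)
  simp only [intervalIntegral.integral_same, mul_zero, zero_mul, sub_zero, zero_sub, mul_neg,
    intervalIntegral.integral_neg, neg_inj] at h3
  rw [← h3]
  simp only [mul_comm]

/-! ### The two-point sphere and the splitting of `½ h_i²`. -/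

theorem mem_S1_iff {ψ : ℝ} : ψ ∈ S1 ↔ ψ = 1 ∨ ψ = -1 := by
  rw [mem_sphere_zero_iff_norm, Real.norm_eq_abs]
  exact abs_eq zero_le_one

theorem supportFn_add_supportFn_neg_nonneg {A : Set ℝ} (hA : A.Nonempty) (hc : IsCompact A) :
    0 ≤ supportFn A 1 + supportFn A (-1) := by
  obtain ⟨y, hy⟩ := hA
  have hb : ∀ ψ : ℝ, y * ψ ≤ supportFn A ψ := fun ψ =>
    le_csSup (hc.image (continuous_mul_const ψ)).bddAbove (mem_image_of_mem _ hy)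
  have h1 := hb 1
  have h2 := hb (-1)
  linarith

namespace Problem

variable {n o r s : ℕ} (P : Problem n o r s)

/-- The `z` terms cancel, and a nonempty set has nonnegative width. Hence `ℓ_i` is positive for at
most one `ψ` in `S_1`. -/
theorem ell_one_add_ell_neg_one_nonpos (i : Fin n) (x z : E n) :
    P.ell i 1 x z + P.ell i (-1) x z ≤ 0 := by
  have h := supportFn_add_supportFn_neg_nonneg (P.F_nonempty i x) (P.F_compact i x)
  simp only [ell]
  linarith

theorem h_eq_max (i : Fin n) (x z : E n) :
    P.h i x z = max (max 0 (P.ell i 1 x z)) (max 0 (P.ell i (-1) x z)) := by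
  have h1 : (1 : ℝ) ∈ S1 := mem_S1_iff.2 (Or.inl rfl)
  have h2 : (-1 : ℝ) ∈ S1 := mem_S1_iff.2 (Or.inr rfl)
  have hle : ∀ ψ : S1, max 0 (P.ell i ψ x z) ≤
      max (max 0 (P.ell i 1 x z)) (max 0 (P.ell i (-1) x z)) := by
    rintro ⟨ψ, hψ⟩
    rcases mem_S1_iff.1 hψ with rfl | rfl
    · exact le_max_left _ _
    · exact le_max_right _ _
  have hb : BddAbove (range fun ψ : S1 => max 0 (P.ell i ψ x z)) :=
    ⟨_, forall_mem_range.2 hle⟩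
  have : Nonempty S1 := ⟨⟨1, h1⟩⟩
  exact le_antisymm (ciSup_le hle) (max_le (le_ciSup hb ⟨1, h1⟩) (le_ciSup hb ⟨-1, h2⟩))

theorem h_nonneg (i : Fin n) (x z : E n) : 0 ≤ P.h i x z := by
  rw [h_eq_max]
  exact (le_max_left _ _).trans (le_max_left _ _)

theorem half_sq_h (i : Fin n) (x z : E n) :
    (1 / 2) * P.h i x z ^ 2 =
      (1 / 2) * max 0 (P.ell i 1 x z) ^ 2 + (1 / 2) * max 0 (P.ell i (-1) x z) ^ 2 := by
  have h := P.ell_one_add_ell_neg_one_nonpos i x z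
  rw [h_eq_max]
  rcases le_total (P.ell i 1 x z) 0 with h1 | h1
  · rw [max_eq_left h1, max_eq_right (le_max_left _ _)]
    ring
  · have h2 : P.ell i (-1) x z ≤ 0 := by linarith
    rw [max_eq_left h2, max_eq_left (le_max_left _ _)]
    ring

/-- If `h_i > 0`, the sign opposite to the maximizer has `ℓ_i ≤ 0` and contributes nothing; if `h_i
= 0`, both sides vanish whatever `ψ0` is. This turns the derivative of the two-term splitting into
an expression in `ψ*`. -/
theorem h_mul_apply_psiStar (ψ0 : Fin n → ℝ) (i : Fin n) (x z : E n) (D : ℝ → ℝ) :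
    P.h i x z * D (P.psiStar ψ0 i x z) =
      max 0 (P.ell i 1 x z) * D 1 + max 0 (P.ell i (-1) x z) * D (-1) := by
  have hsum := P.ell_one_add_ell_neg_one_nonpos i x z
  have hh := P.h_eq_max i x z
  by_cases hpos : 0 < P.h i x z
  · have hψ : P.psiStar ψ0 i x z = Classical.choose (P.exists_maximizer i x z) := if_pos hpos
    obtain ⟨hS, hmax⟩ := Classical.choose_spec (P.exists_maximizer i x z)
    rw [← hψ] at hS hmax
    have h1 := hmax (mem_S1_iff.2 (Or.inl rfl) : (1 : ℝ) ∈ S1)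
    have h2 := hmax (mem_S1_iff.2 (Or.inr rfl) : (-1 : ℝ) ∈ S1)
    simp only [mem_ofPred_eq] at h1 h2
    rcases mem_S1_iff.1 hS with hp | hp
    · rw [hp] at h2 ⊢
      have h3 : P.ell i (-1) x z ≤ 0 := by linarith
      rw [hh, max_eq_left h3, max_eq_left (le_max_left _ _)]
      ring
    · rw [hp] at h1 ⊢
      have h3 : P.ell i 1 x z ≤ 0 := by linarith
      rw [hh, max_eq_left h3, max_eq_right (le_max_left _ _)]
      ring
  · have h0 : P.h i x z = 0 := le_antisymm (not_lt.1 hpos) (P.h_nonneg i x z)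
    rw [h0] at hh
    have h1 : max 0 (P.ell i 1 x z) = 0 :=
      le_antisymm ((le_max_left _ _).trans hh.ge) (le_max_left _ _)
    have h2 : max 0 (P.ell i (-1) x z) = 0 :=
      le_antisymm ((le_max_right _ _).trans hh.ge) (le_max_left _ _)
    rw [h0, h1, h2]
    ring

/-! ### Directional derivatives of `ℓ_i` and of the integrand. -/

theorem ell_eq (i : Fin n) {ψ : ℝ} (hψ : ψ ∈ S1) (x z : E n) :
    P.ell i ψ x z = z i * ψ - ((∑ j, ⨆ q, P.f i j q x * ψ) + ∑ j, ⨅ p, P.g i j p x ψ) := by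
  rw [ell, P.support_eq i x ψ hψ]

theorem locallyLipschitz_ell (i : Fin n) {ψ : ℝ} (hψ : ψ ∈ S1) :
    LocallyLipschitz (fun p : E n × E n => P.ell i ψ p.1 p.2) := by
  simp only [P.ell_eq i hψ, sub_eq_add_neg]
  have hz : ContDiff ℝ 1 (fun p : E n × E n => p.2 i * ψ) := by fun_prop
  have hf : ∀ j q, ContDiff ℝ 1 (fun p : E n × E n => P.f i j q p.1 * ψ) := fun j q =>
    ((P.f_contDiff i j q).comp contDiff_fst).mul contDiff_const
  have hg : ∀ j q, ContDiff ℝ 1 (fun p : E n × E n => P.g i j q p.1 ψ) := fun j q =>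
    (P.g_contDiff i j q ψ hψ).comp contDiff_fst
  refine LocallyLipschitz.add hz.locallyLipschitz (LocallyLipschitz.neg (LocallyLipschitz.add ?_ ?_))
  · exact locallyLipschitz_sum fun j => locallyLipschitz_iSup fun q => (hf j q).locallyLipschitz
  · exact locallyLipschitz_sum fun j => locallyLipschitz_iInf fun q => (hg j q).locallyLipschitz

/-- The directional derivative of `ℓ_i(ψ, ·, ·)` at `(x, z)` in the direction `d`. -/
noncomputable def dEll (i : Fin n) (ψ : ℝ) (x : E n) (d : E n × E n) : ℝ :=
  d.2 i * ψ - ((∑ j, ⨆ q : P.activeMax i j ψ x, inner ℝ (gradient (P.f i j q) x) d.1 * ψ) +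
    ∑ j, ⨅ p : P.activeMin i j ψ x, inner ℝ (gradient (fun y => P.g i j p y ψ) x) d.1)

theorem hasDerivWithinAt_ell (i : Fin n) {ψ : ℝ} (hψ : ψ ∈ S1) (x z : E n) (d : E n × E n) :
    HasDerivWithinAt (fun α : ℝ => P.ell i ψ (x + α • d.1) (z + α • d.2)) (P.dEll i ψ x d)
      (Ioi 0) 0 := by
  simp only [P.ell_eq i hψ, dEll]
  refine HasDerivWithinAt.sub ?_ (HasDerivWithinAt.add (HasDerivWithinAt.fun_sum fun j _ => ?_)
    (HasDerivWithinAt.fun_sum fun j _ => ?_))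
  · have h1 : HasDerivAt (fun α : ℝ => (z i + α * d.2 i) * ψ) (d.2 i * ψ) 0 := by
      simpa using (((hasDerivAt_id (0 : ℝ)).mul_const (d.2 i)).const_add (z i)).mul_const ψ
    exact h1.hasDerivWithinAt
  · have : Nonempty (Fin (P.m j)) := ⟨⟨0, P.m_pos j⟩⟩
    have h1 := hasDerivWithinAt_iSup (a := 0) (A := P.activeMax i j ψ x)
      (φ := fun q α => P.f i j q (x + α • d.1) * ψ)
      (φ' := fun q => inner ℝ (gradient (P.f i j q) x) d.1 * ψ)
      (fun q => by simp only [zero_smul, add_zero]; rfl) (fun q =>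
      ((hasDerivAt_comp_line ((P.f_contDiff i j q).differentiable one_ne_zero x)
        d.1).mul_const ψ).hasDerivWithinAt)
    exact h1
  · have : Nonempty (Fin (P.k j)) := ⟨⟨0, P.k_pos j⟩⟩
    have h1 := hasDerivWithinAt_iInf (a := 0) (A := P.activeMin i j ψ x)
      (φ := fun p α => P.g i j p (x + α • d.1) ψ)
      (φ' := fun p => inner ℝ (gradient (fun y => P.g i j p y ψ) x) d.1)
      (fun p => by simp only [zero_smul, add_zero]; rfl) (fun p =>
      (hasDerivAt_comp_line ((P.g_contDiff i j p ψ hψ).differentiable one_ne_zero x)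
        d.1).hasDerivWithinAt)
    exact h1

theorem continuous_dEll (i : Fin n) (ψ : ℝ) (x : E n) : Continuous (P.dEll i ψ x) := by
  unfold dEll
  refine Continuous.sub (by fun_prop) (Continuous.add (continuous_finsetSum _ fun j _ => ?_)
    (continuous_finsetSum _ fun j _ => ?_))
  · have := Fintype.ofFinite (P.activeMax i j ψ x)
    exact lipschitzWith_iSup_real.continuous.comp
      (continuous_pi fun q : P.activeMax i j ψ x => by fun_prop)
  · have := Fintype.ofFinite (P.activeMin i j ψ x)
    simp only [iInf_eq_neg_iSup_neg]
    exact (lipschitzWith_iSup_real.continuous.comp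
      (continuous_pi fun q : P.activeMin i j ψ x => by fun_prop)).neg

/-- The integrand of `φ + ω`. -/
noncomputable def integrand (p : E n × E n) : ℝ :=
  (1 / 2) * ‖P.hvec p.1 p.2‖ ^ 2 + (1 / 2) * ‖P.e p.1‖ ^ 2

theorem integrand_eq (p : E n × E n) :
    P.integrand p =
      (∑ i, ((1 / 2) * max 0 (P.ell i 1 p.1 p.2) ^ 2 +
        (1 / 2) * max 0 (P.ell i (-1) p.1 p.2) ^ 2)) + ∑ j, (1 / 2) * (P.e p.1 j) ^ 2 := by
  simp only [← half_sq_h]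
  simp only [integrand, EuclideanSpace.real_norm_sq_eq, Finset.mul_sum, hvec]

theorem contDiff_e_apply (j : Fin o) : ContDiff ℝ 1 (fun x => P.e x j) := by
  have := P.e_contDiff
  fun_prop

theorem locallyLipschitz_integrand : LocallyLipschitz P.integrand := by
  rw [show P.integrand = _ from funext P.integrand_eq]
  have hsq : ContDiff ℝ 1 (fun s : ℝ => (1 / 2) * s ^ 2) := by fun_prop
  have h1 : ∀ i, ∀ ψ ∈ S1,
      LocallyLipschitz (fun p : E n × E n => (1 / 2) * max 0 (P.ell i ψ p.1 p.2) ^ 2) :=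
    fun i ψ hψ => hsq.locallyLipschitz.comp ((P.locallyLipschitz_ell i hψ).const_max 0)
  have h2 : ∀ j, ContDiff ℝ 1 (fun p : E n × E n => (1 / 2) * (P.e p.1 j) ^ 2) := fun j =>
    hsq.comp ((P.contDiff_e_apply j).comp contDiff_fst)
  refine LocallyLipschitz.add (locallyLipschitz_sum fun i => LocallyLipschitz.add ?_ ?_)
    (locallyLipschitz_sum fun j => (h2 j).locallyLipschitz)
  · exact h1 i 1 (mem_S1_iff.2 (Or.inl rfl))
  · exact h1 i (-1) (mem_S1_iff.2 (Or.inr rfl))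

/-- The directional derivative of the integrand of `φ + ω`. -/
noncomputable def dIntegrand (ψ0 : Fin n → ℝ) (p d : E n × E n) : ℝ :=
  (∑ i, P.h i p.1 p.2 * P.dEll i (P.psiStar ψ0 i p.1 p.2) p.1 d) +
    ∑ j, P.e p.1 j * inner ℝ (gradient (fun y => P.e y j) p.1) d.1

theorem hasDerivWithinAt_integrand (ψ0 : Fin n → ℝ) (p d : E n × E n) :
    HasDerivWithinAt (fun α : ℝ => P.integrand (p + α • d)) (P.dIntegrand ψ0 p d) (Ioi 0) 0 := by
  simp only [integrand_eq, dIntegrand, Prod.fst_add, Prod.snd_add, Prod.smul_fst, Prod.smul_snd]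
  refine HasDerivWithinAt.add (HasDerivWithinAt.fun_sum fun i _ => ?_)
    (HasDerivWithinAt.fun_sum fun j _ => ?_)
  · rw [P.h_mul_apply_psiStar ψ0 i p.1 p.2 (fun ψ => P.dEll i ψ p.1 d)]
    have key : ∀ ψ ∈ S1, HasDerivWithinAt
        (fun α : ℝ => (1 / 2) * max 0 (P.ell i ψ (p.1 + α • d.1) (p.2 + α • d.2)) ^ 2)
        (max 0 (P.ell i ψ p.1 p.2) * P.dEll i ψ p.1 d) (Ioi 0) 0 := fun ψ hψ => by
      have h1 : HasDerivAt (fun s : ℝ => (1 / 2) * max 0 s ^ 2) (max 0 (P.ell i ψ p.1 p.2))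
          (P.ell i ψ (p.1 + (0 : ℝ) • d.1) (p.2 + (0 : ℝ) • d.2)) := by
        simpa only [zero_smul, add_zero] using hasDerivAt_half_sq_posPart (P.ell i ψ p.1 p.2)
      have h2 := h1.comp_hasDerivWithinAt (0 : ℝ) (P.hasDerivWithinAt_ell i hψ p.1 p.2 d)
      exact h2
    exact (key 1 (mem_S1_iff.2 (Or.inl rfl))).add (key (-1) (mem_S1_iff.2 (Or.inr rfl)))
  · have h1 := hasDerivAt_comp_line ((P.contDiff_e_apply j).differentiable one_ne_zero p.1) d.1
    have h2 := ((h1.fun_pow 2).const_mul (1 / 2 : ℝ)).hasDerivWithinAt (s := Ioi 0)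
    convert h2 using 1
    simp
    ring

theorem continuous_dIntegrand (ψ0 : Fin n → ℝ) (p : E n × E n) :
    Continuous (P.dIntegrand ψ0 p) := by
  unfold dIntegrand
  refine Continuous.add (continuous_finsetSum _ fun i _ => ?_) (by fun_prop)
  exact (P.continuous_dEll i _ _).const_mul _

/-! ### Extremal values of linear functionals on the two differentials, and separation. -/

theorem exists_mem_activeMin (i : Fin n) (j : Fin s) (ψ : ℝ) (x : E n) :
    (P.activeMin i j ψ x).Nonempty := by
  have : Nonempty (Fin (P.k j)) := ⟨⟨0, P.k_pos j⟩⟩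
  exact exists_eq_ciInf_of_finite (f := fun q => P.g i j q x ψ)

/-- The max terms enter `ℓ_i` with a minus sign, so they give a minimum over the superdifferential.
A linear lower bound need only be checked on the generators of each convex hull. -/
theorem le_of_mem_superHalfSq {d : E n × E n} {G : (E n × E n) →L[ℝ] ℝ}
    (hG : ∀ v, G v = inner ℝ v.1 d.1 + inner ℝ v.2 d.2) (ψ0 : Fin n → ℝ) (i : Fin n) (x z : E n)
    {v : E n × E n} (hv : v ∈ P.superHalfSq ψ0 i x z) :
    P.h i x z * (d.2 i * P.psiStar ψ0 i x z -
      ∑ j, ⨆ q : P.activeMax i j (P.psiStar ψ0 i x z) x,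
        inner ℝ (gradient (P.f i j q) x) d.1 * P.psiStar ψ0 i x z) ≤ G v := by
  set ψ := P.psiStar ψ0 i x z
  obtain ⟨_, ⟨_, rfl, w, hw, rfl⟩, rfl⟩ := hv
  obtain ⟨c, hc, rfl⟩ := (Set.mem_fintype_sum _ _).1 hw
  simp only [map_smul, map_add, map_sum, smul_eq_mul]
  refine mul_le_mul_of_nonneg_left ?_ (P.h_nonneg i x z)
  rw [sub_eq_add_neg, ← Finset.sum_neg_distrib]
  refine add_le_add (le_of_eq ?_) (Finset.sum_le_sum fun j _ => ?_)
  · rw [hG]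
    simp only [inner_zero_left, zero_add, real_inner_smul_left, EuclideanSpace.inner_single_left,
      map_one, one_mul]
    exact mul_comm _ _
  · have hconv : Convex ℝ {v | -(⨆ q : P.activeMax i j ψ x,
        inner ℝ (gradient (P.f i j q) x) d.1 * ψ) ≤ G v} :=
      convex_halfSpace_ge G.toLinearMap.isLinear _
    refine convexHull_min ?_ hconv (hc j)
    rintro _ ⟨q, hq, rfl⟩
    have hle := le_ciSup (Finite.bddAbove_range fun q : P.activeMax i j ψ x =>
      inner ℝ (gradient (P.f i j q) x) d.1 * ψ) ⟨q, hq⟩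
    rw [mem_ofPred_eq, hG]
    simp only [inner_neg_left, real_inner_smul_left, inner_zero_left, add_zero, neg_le_neg_iff]
    rw [mul_comm]
    exact hle

/-- Choosing for each `j` an active index that minimizes the inner product attains the contribution
of the min terms to the directional derivative. -/
theorem exists_mem_subHalfSq {d : E n × E n} {G : (E n × E n) →L[ℝ] ℝ}
    (hG : ∀ v, G v = inner ℝ v.1 d.1 + inner ℝ v.2 d.2) (ψ0 : Fin n → ℝ) (i : Fin n)
    (x z : E n) :
    ∃ w ∈ P.subHalfSq ψ0 i x z,
      G w = P.h i x z * -∑ j, ⨅ p : P.activeMin i j (P.psiStar ψ0 i x z) x,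
        inner ℝ (gradient (fun y => P.g i j p y (P.psiStar ψ0 i x z)) x) d.1 := by
  set ψ := P.psiStar ψ0 i x z
  have hne := fun j => (P.exists_mem_activeMin i j ψ x).to_subtype
  choose p hp using fun j => exists_eq_ciInf_of_finite (f := fun p : P.activeMin i j ψ x =>
    (inner ℝ (gradient (fun y => P.g i j p y ψ) x) d.1 : ℝ))
  refine ⟨P.h i x z • ∑ j, (-gradient (fun y => P.g i j (p j) y ψ) x, (0 : E n)),
    smul_mem_smul_set ((Set.mem_fintype_sum _ _).2 ⟨_, fun j => subset_convexHull ℝ _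
      (mem_image_of_mem _ (p j).2), rfl⟩), ?_⟩
  rw [map_smul, map_sum, smul_eq_mul, ← Finset.sum_neg_distrib]
  congr 1
  refine Finset.sum_congr rfl fun j _ => ?_
  rw [hG, ← hp j]
  simp only [inner_neg_left, inner_zero_left, add_zero]

theorem isCompact_convex_sum {V ι : Type*} [NormedAddCommGroup V] [NormedSpace ℝ V]
    (t : Finset ι) (A : ι → Set V) (h : ∀ i ∈ t, IsCompact (A i) ∧ Convex ℝ (A i)) :
    IsCompact (∑ i ∈ t, A i) ∧ Convex ℝ (∑ i ∈ t, A i) := by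
  refine Finset.sum_induction _ (fun B : Set V => IsCompact B ∧ Convex ℝ B)
    (fun B C hB hC => ⟨hB.1.add hC.1, hB.2.add hC.2⟩) ?_ h
  exact ⟨isCompact_singleton, convex_singleton 0⟩

theorem isCompact_convex_subHalfSq (ψ0 : Fin n → ℝ) (i : Fin n) (x z : E n) :
    IsCompact (P.subHalfSq ψ0 i x z) ∧ Convex ℝ (P.subHalfSq ψ0 i x z) := by
  have h := isCompact_convex_sum Finset.univ (fun j => convexHull ℝ
    ((fun p => (-gradient (fun y => P.g i j p y (P.psiStar ψ0 i x z)) x, (0 : E n))) ''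
      P.activeMin i j (P.psiStar ψ0 i x z) x)) fun j _ =>
      ⟨(Set.toFinite _).isCompact_convexHull ℝ, convex_convexHull ℝ _⟩
  exact ⟨h.1.smul _, h.2.smul _⟩

/-- The density of the directional derivative of `I` at `(x, z)`: along `t ↦ φ(t) d` with `φ ≥ 0` the
derivative is the integral of `φ(t)` times the density at `t` and `d`. -/
noncomputable def density (ψ0 : Fin n → ℝ) (x z : ℝ → E n) (t : ℝ) (d : E n × E n) : ℝ :=
  P.dIntegrand ψ0 (x t, z t) d + ∑ j ∈ P.J, P.endDev z j * d.2 j +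
    (inner ℝ (P.dev x z t) d.1 - inner ℝ (∫ τ in t..P.T, P.dev x z τ) d.2)

theorem continuous_density (ψ0 : Fin n → ℝ) (x z : ℝ → E n) (t : ℝ) :
    Continuous (P.density ψ0 x z t) := by
  unfold density
  exact ((P.continuous_dIntegrand ψ0 _).add (by fun_prop)).add (by fun_prop)

theorem neg_superI_subset_subI (ψ0 : Fin n → ℝ) (x z : ℝ → E n) (t : ℝ)
    (h : ∀ d, 0 ≤ P.density ψ0 x z t d) : -P.superI ψ0 x z t ⊆ P.subI ψ0 x z t := by
  intro v hv
  by_contra hvs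
  have hcc : IsCompact (P.subI ψ0 x z t) ∧ Convex ℝ (P.subI ψ0 x z t) := by
    have h1 := isCompact_convex_sum Finset.univ (fun i => P.subHalfSq ψ0 i (x t) (z t))
      fun i _ => P.isCompact_convex_subHalfSq ψ0 i (x t) (z t)
    exact ⟨((h1.1.add isCompact_singleton).add isCompact_singleton).add isCompact_singleton,
      ((h1.2.add (convex_singleton _)).add (convex_singleton _)).add (convex_singleton _)⟩
  obtain ⟨f, u, hfv, hfu⟩ := geometric_hahn_banach_point_closed hcc.2 hcc.1.isClosed hvs
  -- The sign makes `G w < G v` for every `w` in the subdifferential.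
  set G : (E n × E n) →L[ℝ] ℝ := -f with hGf
  -- The product carries the sup norm, so the Riesz representation is applied to each factor
  -- separately.
  set d : E n × E n :=
    ((InnerProductSpace.toDual ℝ (E n)).symm (G.comp (ContinuousLinearMap.inl ℝ (E n) (E n))),
      (InnerProductSpace.toDual ℝ (E n)).symm (G.comp (ContinuousLinearMap.inr ℝ (E n) (E n))))
    with hd
  have hG : ∀ v, G v = inner ℝ v.1 d.1 + inner ℝ v.2 d.2 := fun v => by
    rw [real_inner_comm d.1, real_inner_comm d.2, hd, InnerProductSpace.toDual_symm_apply,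
      InnerProductSpace.toDual_symm_apply, ContinuousLinearMap.comp_apply,
      ContinuousLinearMap.comp_apply, ← map_add]
    simp
  choose w hw hwG using fun i => P.exists_mem_subHalfSq hG ψ0 i (x t) (z t)
  obtain ⟨c, hc, hcv⟩ := (Set.mem_fintype_sum _ _).1 (Set.mem_neg.1 hv)
  have hmem : (∑ i, w i) + P.gradChi z + P.gradOmega x t + P.gradUpsilon x z t ∈
      P.subI ψ0 x z t :=
    add_mem_add (add_mem_add (add_mem_add ((Set.mem_fintype_sum _ _).2 ⟨w, hw, rfl⟩) rfl) rfl) rfl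
  have hlt : G ((∑ i, w i) + P.gradChi z + P.gradOmega x t + P.gradUpsilon x z t) + G (-v) < 0 := by
    have h1 := hfu _ hmem
    simp only [hGf, neg_apply, map_neg] at h1 ⊢
    linarith
  refine absurd (h d) (not_le.2 (lt_of_le_of_lt ?_ hlt))
  have hchi : G (P.gradChi z) = ∑ j ∈ P.J, P.endDev z j * d.2 j := by
    rw [hG, gradChi, inner_zero_left, zero_add, sum_inner]
    simp [real_inner_smul_left, EuclideanSpace.inner_single_left]
  have homega : G (P.gradOmega x t) =
      ∑ j, P.e (x t) j * inner ℝ (gradient (fun y => P.e y j) (x t)) d.1 := by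
    rw [hG, gradOmega, inner_zero_left, add_zero, sum_inner]
    simp only [real_inner_smul_left]
  have hups : G (P.gradUpsilon x z t) =
      inner ℝ (P.dev x z t) d.1 - inner ℝ (∫ τ in t..P.T, P.dev x z τ) d.2 := by
    rw [hG, gradUpsilon, inner_neg_left, sub_eq_add_neg]
  have hsum : ∑ i, P.h i (x t) (z t) * P.dEll i (P.psiStar ψ0 i (x t) (z t)) (x t) d ≤
      (∑ i, G (w i)) + ∑ i, G (c i) := by
    rw [← Finset.sum_add_distrib]
    refine Finset.sum_le_sum fun i _ => ?_
    have h1 := P.le_of_mem_superHalfSq hG ψ0 i (x t) (z t) (hc i)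
    rw [hwG, dEll]
    linarith
  rw [← hcv]
  simp only [map_add, map_sum, hchi, homega, hups, density, dIntegrand]
  linarith

end Problem

/-! ### Measurability, integrability and variations of admissible paths. -/

section Paths

variable {n : ℕ} {T : ℝ} {x z : ℝ → E n}

theorem IsC.exists_bound (hx : IsC T x) : ∃ M, ∀ t ∈ Icc 0 T, ‖x t‖ ≤ M :=
  isCompact_Icc.exists_bound_of_continuousOn hx

theorem IsC.aestronglyMeasurable (hx : IsC T x) :
    AEStronglyMeasurable x (volume.restrict (Ioc 0 T)) :=
  (hx.mono Ioc_subset_Icc_self).aestronglyMeasurable measurableSet_Ioc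

theorem IsC.add_smul {φ : ℝ → ℝ} (hx : IsC T x) (hφ : Continuous φ) (a : E n) (ε : ℝ) :
    IsC T (fun t => x t + ε • φ t • a) :=
  hx.add (by fun_prop)

theorem IsP.aestronglyMeasurable (hz : IsP T z) :
    AEStronglyMeasurable z (volume.restrict (Ioc 0 T)) := by
  obtain ⟨⟨D, hD⟩, -⟩ := hz
  have hm : MeasurableSet (Ioc 0 T \ (D : Set ℝ)) := measurableSet_Ioc.diff D.measurableSet
  have hc : ContinuousOn z (Ioc 0 T \ (D : Set ℝ)) := fun t ht =>
    (hD t (Ioc_subset_Icc_self ht.1) ht.2).mono (sdiff_subset.trans Ioc_subset_Icc_self)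
  have he : (Ioc 0 T \ (D : Set ℝ) : Set ℝ) =ᵐ[volume] Ioc 0 T :=
    sdiff_null_ae_eq_self (D.finite_toSet.measure_zero volume)
  rw [← Measure.restrict_congr_set he]
  exact hc.aestronglyMeasurable hm

theorem IsP.add_smul {φ : ℝ → ℝ} (hz : IsP T z) (hφ : Continuous φ) (a : E n) (ε : ℝ) :
    IsP T (fun t => z t + ε • φ t • a) := by
  obtain ⟨⟨D, hD⟩, M, hM⟩ := hz
  have hc : Continuous (fun t => ε • φ t • a) := by fun_prop
  obtain ⟨N, hN⟩ := isCompact_Icc.exists_bound_of_continuousOn (hc.continuousOn (s := Icc 0 T))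
  exact ⟨⟨D, fun t ht htD => (hD t ht htD).add hc.continuousWithinAt⟩,
    M + N, fun t ht => (norm_add_le _ _).trans (add_le_add (hM t ht) (hN t ht))⟩

theorem IsP.intervalIntegrable (hT : 0 ≤ T) (hz : IsP T z) : IntervalIntegrable z volume 0 T := by
  rw [intervalIntegrable_iff_integrableOn_Ioc_of_le hT]
  obtain ⟨M, hM⟩ := hz.2
  refine Integrable.of_bound hz.aestronglyMeasurable M ?_
  filter_upwards [ae_restrict_mem measurableSet_Ioc] with t ht using hM t (Ioc_subset_Icc_self ht)

theorem intervalIntegral_apply {t : ℝ} (hz : IntervalIntegrable z volume 0 t) (j : Fin n) :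
    ∫ τ in (0 : ℝ)..t, z τ j = (∫ τ in (0 : ℝ)..t, z τ) j :=
  (EuclideanSpace.proj j : E n →L[ℝ] ℝ).intervalIntegral_comp_comm hz

theorem intervalIntegral_add_smul {t : ℝ} (hz : IntervalIntegrable z volume 0 t) {φ : ℝ → ℝ}
    (hφ : Continuous φ) (a : E n) (ε : ℝ) :
    ∫ τ in (0 : ℝ)..t, (z τ + ε • φ τ • a) =
      (∫ τ in (0 : ℝ)..t, z τ) + ε • (∫ τ in (0 : ℝ)..t, φ τ) • a := by
  have hc : Continuous (fun t => ε • φ t • a) := by fun_prop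
  rw [intervalIntegral.integral_add hz (hc.intervalIntegrable _ _),
    intervalIntegral.integral_smul, intervalIntegral.integral_smul_const]

end Paths

/-! ### The right derivative of `I` and the minimum condition. -/

namespace Problem

variable {n o r s : ℕ} (P : Problem n o r s) {x z : ℝ → E n}

theorem intervalIntegrable_of_mem (hz : IsP P.T z) {t : ℝ} (ht : t ∈ Icc 0 P.T) :
    IntervalIntegrable z volume 0 t :=
  (hz.intervalIntegrable P.T_pos.le).mono_set (by
    rw [uIcc_of_le ht.1, uIcc_of_le P.T_pos.le]
    exact Icc_subset_Icc_right ht.2)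

theorem continuousOn_dev (hx : IsC P.T x) (hz : IsP P.T z) :
    ContinuousOn (P.dev x z) (Icc 0 P.T) := by
  have h := intervalIntegral.continuousOn_primitive_interval'
    (hz.intervalIntegrable P.T_pos.le) left_mem_uIcc
  rw [uIcc_of_le P.T_pos.le] at h
  exact (hx.sub continuousOn_const).sub h

theorem continuousOn_integral_dev (hx : IsC P.T x) (hz : IsP P.T z) :
    ContinuousOn (fun t => ∫ τ in t..P.T, P.dev x z τ) (Icc 0 P.T) := by
  have h := intervalIntegral.continuousOn_primitive_interval_left (f := P.dev x z)
    (a := 0) (b := P.T) (μ := volume) (by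
      rw [uIcc_of_le P.T_pos.le]
      exact (P.continuousOn_dev hx hz).integrableOn_Icc)
  rwa [uIcc_of_le P.T_pos.le] at h

theorem endDev_add_smul (hz : IsP P.T z) {φ : ℝ → ℝ} (hφ : Continuous φ) (b : E n) (ε : ℝ)
    (j : Fin n) :
    P.endDev (fun t => z t + ε • φ t • b) j =
      P.endDev z j + ε * ((∫ t in (0 : ℝ)..P.T, φ t) * b j) := by
  have hT := P.T_pos.le
  rw [endDev, endDev, intervalIntegral_apply ((hz.add_smul hφ b ε).intervalIntegrable hT),
    intervalIntegral_add_smul (hz.intervalIntegrable hT) hφ,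
    intervalIntegral_apply (hz.intervalIntegrable hT)]
  simp only [PiLp.add_apply, PiLp.smul_apply, smul_eq_mul]
  ring

theorem dev_add_smul (hz : IsP P.T z) {φ : ℝ → ℝ} (hφ : Continuous φ) (d : E n × E n) (ε : ℝ)
    {t : ℝ} (ht : t ∈ Icc 0 P.T) :
    P.dev (fun t => x t + ε • φ t • d.1) (fun t => z t + ε • φ t • d.2) t =
      P.dev x z t + ε • (φ t • d.1 - (∫ τ in (0 : ℝ)..t, φ τ) • d.2) := by
  rw [dev, dev, intervalIntegral_add_smul (P.intervalIntegrable_of_mem hz ht) hφ, smul_sub]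
  abel

theorem ae_norm_prod_le (hx : IsC P.T x) (hz : IsP P.T z) :
    ∃ M, ∀ᵐ t ∂(volume.restrict (Ioc 0 P.T)), ‖(x t, z t)‖ ≤ M := by
  obtain ⟨M, hM⟩ := hx.exists_bound
  obtain ⟨N, hN⟩ := hz.2
  refine ⟨max M N, ?_⟩
  filter_upwards [ae_restrict_mem measurableSet_Ioc] with t ht
  exact max_le_max (hM t (Ioc_subset_Icc_self ht)) (hN t (Ioc_subset_Icc_self ht))

theorem phi_add_omega (hx : IsC P.T x) (hz : IsP P.T z) :
    P.phi x z + P.omega x = ∫ t in Ioc 0 P.T, P.integrand (x t, z t) := by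
  obtain ⟨M, hb⟩ := P.ae_norm_prod_le hx hz
  have hm := hx.aestronglyMeasurable.prodMk hz.aestronglyMeasurable
  have h2 : Continuous (fun p : E n × E n => (1 / 2) * ‖P.e p.1‖ ^ 2) := by
    have := P.e_contDiff.continuous
    fun_prop
  -- Continuity is known for the whole integrand, so the `h` term is recovered by subtracting the
  -- smooth `e` term.
  have h1 : Continuous (fun p : E n × E n => (1 / 2) * ‖P.hvec p.1 p.2‖ ^ 2) := by
    refine (P.locallyLipschitz_integrand.continuous.sub h2).congr fun p => ?_
    simp [integrand]
  rw [phi, omega, intervalIntegral.integral_of_le P.T_pos.le,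
    intervalIntegral.integral_of_le P.T_pos.le, ← integral_const_mul, ← integral_const_mul]
  exact (integral_add (integrable_comp_of_bounded h1 hm hb)
    (integrable_comp_of_bounded h2 hm hb)).symm

theorem hasDerivWithinAt_chi (hz : IsP P.T z) {φ : ℝ → ℝ} (hφ : Continuous φ) (b : E n) :
    HasDerivWithinAt (fun ε : ℝ => P.chi (fun t => z t + ε • φ t • b))
      (∫ t in (0 : ℝ)..P.T, φ t * ∑ j ∈ P.J, P.endDev z j * b j) (Ioi 0) 0 := by
  simp only [chi, P.endDev_add_smul hz hφ]
  set c := ∫ t in (0 : ℝ)..P.T, φ t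
  have h1 : ∀ j ∈ P.J, HasDerivAt (fun ε : ℝ => (P.endDev z j + ε * (c * b j)) ^ 2)
      (2 * (P.endDev z j * (c * b j))) 0 := fun j _ => by
    have h2 := (((hasDerivAt_id (0 : ℝ)).mul_const (c * b j)).const_add (P.endDev z j)).fun_pow 2
    refine h2.congr_deriv ?_
    simp only [id, zero_mul, add_zero, one_mul, Nat.cast_ofNat, Nat.add_one_sub_one, pow_one]
    ring
  have h3 := ((HasDerivAt.fun_sum h1).const_mul (1 / 2 : ℝ)).hasDerivWithinAt (s := Ioi 0)
  refine h3.congr_deriv ?_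
  rw [intervalIntegral.integral_mul_const, Finset.mul_sum, Finset.mul_sum]
  exact Finset.sum_congr rfl fun j _ => by ring

/-- The deviation is affine in `ε` with slope `φ a - (∫_0^t φ) b`. Exchanging the order of
integration moves the primitive off `φ` and onto the deviation, producing the tail integral in the
gradient of υ. -/
theorem hasDerivWithinAt_upsilon (hx : IsC P.T x) (hz : IsP P.T z) {φ : ℝ → ℝ}
    (hφ : Continuous φ) (d : E n × E n) :
    HasDerivWithinAt
      (fun ε : ℝ => P.upsilon (fun t => x t + ε • φ t • d.1) (fun t => z t + ε • φ t • d.2))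
      (∫ t in (0 : ℝ)..P.T, φ t *
        (inner ℝ (P.dev x z t) d.1 - inner ℝ (∫ τ in t..P.T, P.dev x z τ) d.2)) (Ioi 0) 0 := by
  have hT := P.T_pos.le
  have hdev := P.continuousOn_dev hx hz
  have hint := P.continuousOn_integral_dev hx hz
  have hΦ : Continuous (fun t => ∫ τ in (0 : ℝ)..t, φ τ) :=
    intervalIntegral.continuous_primitive (fun a b => hφ.intervalIntegrable a b) 0
  have hv : Continuous (fun t => φ t • d.1 - (∫ τ in (0 : ℝ)..t, φ τ) • d.2) := by fun_prop
  obtain ⟨M, hM⟩ := isCompact_Icc.exists_bound_of_continuousOn hdev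
  obtain ⟨N, hN⟩ := isCompact_Icc.exists_bound_of_continuousOn (hv.continuousOn (s := Icc 0 P.T))
  have hsq : ContDiff ℝ 1 (fun y : E n => (1 / 2) * ‖y‖ ^ 2) :=
    contDiff_const.mul (contDiff_norm_sq ℝ)
  have hder := hasDerivWithinAt_integral_line (μ := volume.restrict (Ioc 0 P.T))
    (L := fun y : E n => (1 / 2) * ‖y‖ ^ 2) (p := P.dev x z)
    (u := fun t => φ t • d.1 - (∫ τ in (0 : ℝ)..t, φ τ) • d.2)
    (l := fun t => inner ℝ (P.dev x z t) (φ t • d.1 - (∫ τ in (0 : ℝ)..t, φ τ) • d.2))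
    hsq.locallyLipschitz
    ((hdev.mono Ioc_subset_Icc_self).aestronglyMeasurable measurableSet_Ioc)
    hv.aestronglyMeasurable (M := M) (N := N)
    (by filter_upwards [ae_restrict_mem measurableSet_Ioc] with t ht
        using hM t (Ioc_subset_Icc_self ht))
    (by filter_upwards [ae_restrict_mem measurableSet_Ioc] with t ht
        using hN t (Ioc_subset_Icc_self ht))
    (Eventually.of_forall fun t => by
      set u := φ t • d.1 - (∫ τ in (0 : ℝ)..t, φ τ) • d.2
      have h1 : HasDerivAt (fun ε : ℝ => P.dev x z t + ε • u) u 0 := by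
        simpa using ((hasDerivAt_id (0 : ℝ)).smul_const u).const_add (P.dev x z t)
      have h2 := (h1.norm_sq.const_mul (1 / 2 : ℝ)).hasDerivWithinAt (s := Ioi 0)
      refine h2.congr_deriv ?_
      simp only [zero_smul, add_zero]
      ring)
  have heq : ∀ ε : ℝ,
      P.upsilon (fun t => x t + ε • φ t • d.1) (fun t => z t + ε • φ t • d.2) =
      ∫ t in Ioc 0 P.T, (1 / 2) *
        ‖P.dev x z t + ε • (φ t • d.1 - (∫ τ in (0 : ℝ)..t, φ τ) • d.2)‖ ^ 2 := fun ε => by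
    rw [upsilon, intervalIntegral.integral_of_le hT, ← integral_const_mul]
    refine setIntegral_congr_fun measurableSet_Ioc fun t ht => ?_
    simp only [P.dev_add_smul hz hφ d ε (Ioc_subset_Icc_self ht)]
  rw [funext heq]
  refine hder.congr_deriv ?_
  symm
  rw [← intervalIntegral.integral_of_le hT]
  have hii : ∀ {f : ℝ → ℝ}, ContinuousOn f (Icc 0 P.T) → IntervalIntegrable f volume 0 P.T :=
    fun hf => hf.intervalIntegrable_of_Icc hT
  have hφc := hφ.continuousOn (s := Icc 0 P.T)
  have hswap := integral_mul_integral_left hT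
    (hdev.inner continuousOn_const : ContinuousOn (fun t => inner ℝ (P.dev x z t) d.2) _) hφ
  simp only [inner_sub_right, inner_smul_right, mul_sub]
  rw [intervalIntegral.integral_sub (hii (hφc.fun_mul (hdev.inner continuousOn_const)))
    (hii (hφc.fun_mul (hint.inner continuousOn_const))), intervalIntegral.integral_sub
    (hii (hφc.fun_mul (hdev.inner continuousOn_const)))
    (hii (hΦ.continuousOn.fun_mul (hdev.inner continuousOn_const)))]
  congr 1
  simp only [mul_comm (∫ τ in (0 : ℝ).._, φ τ)]
  rw [hswap]
  refine intervalIntegral.integral_congr fun t ht => ?_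
  rw [uIcc_of_le hT] at ht
  have hdi : IntervalIntegrable (P.dev x z) volume t P.T :=
    (hdev.mono (Icc_subset_Icc_left ht.1)).intervalIntegrable_of_Icc ht.2
  have hin := ((innerSL ℝ) d.2).intervalIntegral_comp_comm hdi
  simp only [innerSL_apply_apply] at hin
  simp only [real_inner_comm d.2] at hin ⊢
  rw [hin]

theorem aestronglyMeasurable_dIntegrand (ψ0 : Fin n → ℝ) (hx : IsC P.T x) (hz : IsP P.T z)
    (d : E n × E n) :
    AEStronglyMeasurable (fun t => P.dIntegrand ψ0 (x t, z t) d) (volume.restrict (Ioc 0 P.T)) :=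
  aestronglyMeasurable_of_hasDerivWithinAt_line P.locallyLipschitz_integrand.continuous
    (hx.aestronglyMeasurable.prodMk hz.aestronglyMeasurable) aestronglyMeasurable_const
    (Eventually.of_forall fun _ => P.hasDerivWithinAt_integrand ψ0 _ d)

theorem exists_bound_dIntegrand (ψ0 : Fin n → ℝ) (hx : IsC P.T x) (hz : IsP P.T z)
    (d : E n × E n) :
    ∃ C, ∀ᵐ t ∂(volume.restrict (Ioc 0 P.T)), |P.dIntegrand ψ0 (x t, z t) d| ≤ C := by
  obtain ⟨M, hM⟩ := P.ae_norm_prod_le hx hz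
  obtain ⟨C, -, hC⟩ := exists_lipschitz_bound P.locallyLipschitz_integrand M ‖d‖
  refine ⟨C, ?_⟩
  filter_upwards [hM] with t ht
  exact abs_le_of_hasDerivWithinAt_line (P.hasDerivWithinAt_integrand ψ0 _ d)
    (hC _ d ht le_rfl)

theorem hasDerivWithinAt_phi_add_omega (ψ0 : Fin n → ℝ) (hx : IsC P.T x) (hz : IsP P.T z)
    {φ : ℝ → ℝ} (hφ : Continuous φ) (hφ0 : ∀ t, 0 ≤ φ t) (d : E n × E n) :
    HasDerivWithinAt
      (fun ε : ℝ => P.phi (fun t => x t + ε • φ t • d.1) (fun t => z t + ε • φ t • d.2) +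
        P.omega (fun t => x t + ε • φ t • d.1))
      (∫ t in (0 : ℝ)..P.T, φ t * P.dIntegrand ψ0 (x t, z t) d) (Ioi 0) 0 := by
  simp only [fun ε => P.phi_add_omega (hx.add_smul hφ d.1 ε) (hz.add_smul hφ d.2 ε)]
  rw [intervalIntegral.integral_of_le P.T_pos.le]
  obtain ⟨M, hM⟩ := P.ae_norm_prod_le hx hz
  have hv : Continuous (fun t => φ t • d) := by fun_prop
  obtain ⟨N, hN⟩ := isCompact_Icc.exists_bound_of_continuousOn (hv.continuousOn (s := Icc 0 P.T))
  exact hasDerivWithinAt_integral_line P.locallyLipschitz_integrand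
    (p := fun t => (x t, z t)) (u := fun t => φ t • d)
    (hx.aestronglyMeasurable.prodMk hz.aestronglyMeasurable) hv.aestronglyMeasurable hM
    (by filter_upwards [ae_restrict_mem measurableSet_Ioc] with t ht
        using hN t (Ioc_subset_Icc_self ht))
    (Eventually.of_forall fun t =>
      hasDerivWithinAt_line_smul (P.hasDerivWithinAt_integrand ψ0 _ d) (hφ0 t))

theorem continuousOn_inner_dev (hx : IsC P.T x) (hz : IsP P.T z) (d : E n × E n) :
    ContinuousOn (fun t => (inner ℝ (P.dev x z t) d.1 : ℝ) -
      inner ℝ (∫ τ in t..P.T, P.dev x z τ) d.2) (Icc 0 P.T) :=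
  ((P.continuousOn_dev hx hz).inner continuousOn_const).sub
    ((P.continuousOn_integral_dev hx hz).inner continuousOn_const)

theorem aestronglyMeasurable_density (ψ0 : Fin n → ℝ) (hx : IsC P.T x) (hz : IsP P.T z)
    (d : E n × E n) :
    AEStronglyMeasurable (fun t => P.density ψ0 x z t d) (volume.restrict (Ioc 0 P.T)) :=
  ((P.aestronglyMeasurable_dIntegrand ψ0 hx hz d).add aestronglyMeasurable_const).add
    (((P.continuousOn_inner_dev hx hz d).mono Ioc_subset_Icc_self).aestronglyMeasurable
      measurableSet_Ioc)

theorem exists_bound_density (ψ0 : Fin n → ℝ) (hx : IsC P.T x) (hz : IsP P.T z)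
    (d : E n × E n) :
    ∃ C, ∀ᵐ t ∂(volume.restrict (Ioc 0 P.T)), |P.density ψ0 x z t d| ≤ C := by
  obtain ⟨C, hC⟩ := P.exists_bound_dIntegrand ψ0 hx hz d
  obtain ⟨N, hN⟩ := isCompact_Icc.exists_bound_of_continuousOn (P.continuousOn_inner_dev hx hz d)
  refine ⟨C + |∑ j ∈ P.J, P.endDev z j * d.2 j| + N, ?_⟩
  filter_upwards [hC, ae_restrict_mem measurableSet_Ioc] with t h1 ht
  refine (abs_add_le _ _).trans (add_le_add ((abs_add_le _ _).trans (add_le_add h1 le_rfl)) ?_)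
  exact hN t (Ioc_subset_Icc_self ht)

theorem hasDerivWithinAt_I (ψ0 : Fin n → ℝ) (hx : IsC P.T x) (hz : IsP P.T z)
    {φ : ℝ → ℝ} (hφ : Continuous φ) (hφ0 : ∀ t, 0 ≤ φ t) (d : E n × E n) :
    HasDerivWithinAt
      (fun ε : ℝ => P.I (fun t => x t + ε • φ t • d.1) (fun t => z t + ε • φ t • d.2))
      (∫ t in (0 : ℝ)..P.T, φ t * P.density ψ0 x z t d) (Ioi 0) 0 := by
  have hT := P.T_pos.le
  have h := ((P.hasDerivWithinAt_phi_add_omega ψ0 hx hz hφ hφ0 d).add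
    (P.hasDerivWithinAt_chi hz hφ d.2)).add (P.hasDerivWithinAt_upsilon hx hz hφ d)
  have hφi : IntegrableOn φ (Ioc 0 P.T) := hφ.integrableOn_Ioc
  obtain ⟨C, hC⟩ := P.exists_bound_dIntegrand ψ0 hx hz d
  have i1 : IntervalIntegrable (fun t => φ t * P.dIntegrand ψ0 (x t, z t) d) volume 0 P.T := by
    rw [intervalIntegrable_iff_integrableOn_Ioc_of_le hT]
    exact hφi.mul_bdd (c := C) (P.aestronglyMeasurable_dIntegrand ψ0 hx hz d) hC
  have i2 : IntervalIntegrable (fun t => φ t * ∑ j ∈ P.J, P.endDev z j * d.2 j) volume 0 P.T :=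
    (hφ.mul continuous_const).intervalIntegrable _ _
  have i3 : IntervalIntegrable (fun t => φ t *
      (inner ℝ (P.dev x z t) d.1 - inner ℝ (∫ τ in t..P.T, P.dev x z τ) d.2)) volume 0 P.T :=
    (hφ.continuousOn.mul (P.continuousOn_inner_dev hx hz d)).intervalIntegrable_of_Icc hT
  rw [← intervalIntegral.integral_add i1 i2, ← intervalIntegral.integral_add (i1.add i2) i3] at h
  have hI : (fun ε : ℝ =>
      P.I (fun t => x t + ε • φ t • d.1) (fun t => z t + ε • φ t • d.2)) = _ :=
    funext fun ε => by rw [I, add_right_comm (P.phi _ _)]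
  rw [hI]
  refine h.congr_deriv ?_
  simp only [density, mul_add]

theorem ae_density_nonneg (ψ0 : Fin n → ℝ) (hmin : P.IsMinimizer x z) (d : E n × E n) :
    ∀ᵐ t ∂(volume.restrict (Ioc 0 P.T)), 0 ≤ P.density ψ0 x z t d := by
  obtain ⟨hx, hz, hle⟩ := hmin
  obtain ⟨C, hC⟩ := P.exists_bound_density ψ0 hx hz d
  refine ae_nonneg_of_forall_integral_continuous_mul
    (P.aestronglyMeasurable_density ψ0 hx hz d) hC fun φ hφ hφ0 _ => ?_
  rw [← intervalIntegral.integral_of_le P.T_pos.le]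
  refine nonneg_of_hasDerivWithinAt_of_forall_le (P.hasDerivWithinAt_I ψ0 hx hz hφ hφ0 d) fun ε => ?_
  simp only [zero_smul, add_zero]
  exact hle _ _ (hx.add_smul hφ d.1 ε) (hz.add_smul hφ d.2 ε)

theorem IsMinimizer.minCondition (ψ0 : Fin n → ℝ) (hmin : P.IsMinimizer x z) :
    P.MinCondition ψ0 x z := by
  rw [MinCondition, ← Measure.restrict_congr_set Ioc_ae_eq_Icc]
  -- The exceptional null set depends on the direction, so the union is taken over a dense sequence
  -- only; continuity of the density in `d` covers the rest.
  filter_upwards [ae_all_iff.2 fun k =>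
    P.ae_density_nonneg ψ0 hmin (TopologicalSpace.denseSeq (E n × E n) k)] with t ht
  refine P.neg_superI_subset_subI ψ0 x z t fun d => ?_
  exact (TopologicalSpace.denseRange_denseSeq (E n × E n)).induction_on (p := fun d =>
    0 ≤ P.density ψ0 x z t d) d
    (isClosed_le continuous_const (P.continuous_density ψ0 x z t)) ht

theorem I_nonneg (x z : ℝ → E n) : 0 ≤ P.I x z := by
  have hnn : ∀ {f : ℝ → ℝ}, (∀ t, 0 ≤ f t) → 0 ≤ (1 / 2) * ∫ t in (0 : ℝ)..P.T, f t :=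
    fun hf => mul_nonneg (by norm_num)
      (intervalIntegral.integral_nonneg P.T_pos.le fun t _ => hf t)
  refine add_nonneg (add_nonneg (add_nonneg ?_ ?_) ?_) ?_
  · exact hnn fun t => sq_nonneg _
  · exact mul_nonneg (by norm_num) (Finset.sum_nonneg fun j _ => sq_nonneg _)
  · exact hnn fun t => sq_nonneg _
  · exact hnn fun t => sq_nonneg _

end Problem

end QDI

theorem mainTheorem2 {n o r s : ℕ} (P : QDI.Problem n o r s)
    (ψ0 : Fin n → ℝ) (hψ0 : ∀ i, ψ0 i ∈ QDI.S1)
    (x z : ℝ → QDI.E n) (hx : QDI.IsC P.T x) (hz : QDI.IsP P.T z)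
    (hsplit : P.FiniteSplitting x) :
    (P.IsMinimizer x z → P.MinCondition ψ0 x z) ∧
      (P.I x z = 0 → P.MinCondition ψ0 x z → P.IsMinimizer x z) :=
  ⟨fun hmin => hmin.minCondition P ψ0,
    fun h0 _ => ⟨hx, hz, fun x' z' _ _ => h0.le.trans (P.I_nonneg x' z')⟩⟩
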